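/- **Theorem.** A *0-bend apRAC drawing* of a finite simple graph places the vertices at distinct points of the Euclidean plane $\mathbb{R}^2$ and draws every edge as the straight-line segment between its ends, such that no edge passes through a vertex other than its ends, any two edges that have a common interior point are perpendicular, and both of them are axis-parallel (one is horizontal, the other vertical). A graph is *0-bend apRAC* if it admits such a drawing. 1. Every 0-bend apRAC graph with $n \ge 3$ vertices has at most $4n - \sqrt{n} - 6$ edges. 2. There is an infinite family of 0-bend apRAC graphs with $n$ vertices and exactly $4n - 2\lfloor\sqrt{n}\rfloor - 7$ edges. More precisely, for every even $k > 0$ let $G_k$ be the graph obtained from the $k \times k$ grid graph on $\{0,\dots,k-1\}^2$ by adding both diagonals of every quadrangular face and then two adjacent vertices $N$ and $S$, where $N$ is joined to the $2k-1$ boundary vertices $(i,j)$ with $i = k-1$ or $j = k-1$, and $S$ is joined to the $2k-1$ boundary vertices $(i,j)$ with $i = 0$ or $j = 0$. Then $G_k$ has $n = k^2 + 2$ vertices, is 0-bend apRAC, and has exactly $4n - 2\lfloor\sqrt{n}\rfloor - 7$ edges. -/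

import Mathlib

open scoped InnerProductSpace

/-- The Euclidean plane; `a 0` is the x-coordinate and `a 1` the y-coordinate of `a`. -/
abbrev Plane : Type := EuclideanSpace ℝ (Fin 2)

/-- A straight-line (that is, 0-bend) drawing of a graph: vertices are placed at distinct points,
an edge `uv` is drawn as the segment from `p u` to `p v`, and no edge passes through a vertex
other than its two ends. -/
structure IsStraightLineDrawing {V : Type*} (G : SimpleGraph V) (p : V → Plane) : Prop where
  injective : Function.Injective p
  vertex_notMem : ∀ ⦃u v w : V⦄, G.Adj u v → w ≠ u → w ≠ v → p w ∉ segment ℝ (p u) (p v)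

/-- The two different edges `uv` and `wz` have an interior point in common in the drawing `p`. -/
def EdgesCross {V : Type*} (p : V → Plane) (u v w z : V) : Prop :=
  s(u, v) ≠ s(w, z) ∧ (openSegment ℝ (p u) (p v) ∩ openSegment ℝ (p w) (p z)).Nonempty

/-- A 0-bend RAC drawing: any two crossing edges are perpendicular. In particular, no two edges
overlap. -/
structure IsRACDrawing {V : Type*} (G : SimpleGraph V) (p : V → Plane) : Prop
    extends IsStraightLineDrawing G p where
  right_angle : ∀ ⦃u v w z : V⦄, G.Adj u v → G.Adj w z → EdgesCross p u v w z →
    ⟪p v - p u, p z - p w⟫_ℝ = 0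

/-- The segment from `a` to `b` is vertical or horizontal. -/
def IsAxisParallel (a b : Plane) : Prop := a 0 = b 0 ∨ a 1 = b 1

/-- A 0-bend apRAC drawing: a 0-bend RAC drawing in which every edge that is involved in a
crossing is axis-parallel. -/
structure IsApRACDrawing {V : Type*} (G : SimpleGraph V) (p : V → Plane) : Prop
    extends IsRACDrawing G p where
  axis_parallel : ∀ ⦃u v w z : V⦄, G.Adj u v → G.Adj w z → EdgesCross p u v w z →
    IsAxisParallel (p u) (p v) ∧ IsAxisParallel (p w) (p z)

/-- A 0-bend apRAC graph is a graph that admits a 0-bend apRAC drawing. -/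
def IsApRACGraph {V : Type*} (G : SimpleGraph V) : Prop :=
  ∃ p : V → Plane, IsApRACDrawing G p

/-- The pairs of diagonals of the quadrangular faces of the `k × k` grid. -/
def gridDiagonals (k : ℕ) : SimpleGraph (Fin k × Fin k) where
  Adj a b := (SimpleGraph.pathGraph k).Adj a.1 b.1 ∧ (SimpleGraph.pathGraph k).Adj a.2 b.2
  symm := ⟨fun _ _ h => ⟨h.1.symm, h.2.symm⟩⟩
  loopless := ⟨fun _ h => h.1.ne rfl⟩

/-- The `k × k` grid graph with both diagonals of every quadrangular face. -/
def crossedGrid (k : ℕ) : SimpleGraph (Fin k × Fin k) :=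
  (SimpleGraph.pathGraph k □ SimpleGraph.pathGraph k) ⊔ gridDiagonals k

/-- The crossed grid with two extra vertices `N = inr true` and `S = inr false`, which are
adjacent to each other. `N` is joined to the `2 * k - 1` consecutive boundary vertices of the grid
on the two sides at the corner `(k - 1, k - 1)`, and `S` to those on the two sides at the corner
`(0, 0)`. -/
def apexCrossedGrid (k : ℕ) : SimpleGraph ((Fin k × Fin k) ⊕ Bool) :=
  SimpleGraph.fromRel fun x y => match x, y with
    | .inl a, .inl b => (crossedGrid k).Adj a b
    | .inl a, .inr true => (a.1 : ℕ) + 1 = k ∨ (a.2 : ℕ) + 1 = k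
    | .inl a, .inr false => (a.1 : ℕ) = 0 ∨ (a.2 : ℕ) = 0
    | .inr true, .inr false => True
    | _, _ => False

/-! Upper bound. Two crossing edges are perpendicular to different axes. So for each coordinate `i`,
the edges along which coordinate `i` varies are pairwise noncrossing, and there are at most `3n - 6`
of them. The remaining edges lie on the lines "coordinate `i` = constant". On each used line they
join consecutive vertices only, so with `k i` such lines they number at most `n - k i`. Hence there
are at most `4n - 6 - k i` edges for both `i`. The vertices embed in the product of the two sets of
coordinates, so `n ≤ k 0 * k 1` and some `k i ≥ √n`.

The planar bound `IsPlane.card_add_six_le` is proved by charging instead of Euler's formula. After a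
shear, abscissas are distinct and edges run from left to right. The lowest edge entering each vertex
is charged to that vertex, which gives at most `n - 1` edges. Every other edge bounds a wedge with
the next lower edge at its right end, and is charged to the rightmost vertex `w` of that wedge.
Either `w` is its left end or `w` lies strictly below it; each vertex other than the leftmost and
the rightmost is charged at most once in each way. A further extreme vertex escapes one of the two
charges, so the total is `(n - 1) + (n - 2) + (n - 3)`.

Construction. In the grid rotated by `π / 4`, only the two diagonals of one face cross, and they are
axis-parallel. Both apices lie on a vertical line to the right of the grid, and disjoint regions
separate the edge classes. -/

/-! ### Plane straight-line graphs: the bound `3n - 6` -/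

namespace PlaneGraph

variable {V : Type*} (X Y : V → ℝ)

/-- The slope of the line through the points of `u` and `v`. -/
noncomputable def slope (u v : V) : ℝ := (Y v - Y u) / (X v - X u)

/-- The height at abscissa `t` of the line through the points of `u` and `v`. -/
noncomputable def height (u v : V) (t : ℝ) : ℝ := Y v - slope X Y u v * (X v - t)

variable {X Y}

lemma height_right (u v : V) : height X Y u v (X v) = Y v := by simp [height]

lemma height_left {u v : V} (h : X u < X v) : height X Y u v (X u) = Y u := by
  have : X v - X u ≠ 0 := by linarith
  unfold height slope
  field_simp
  ring

/-- Lines are compared to the left of a common right end, so the steeper one is the lower one; this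
fixes the order of edges entering a vertex. -/
lemma height_lt_of_slope_lt {u u' v : V} {t : ℝ} (h : slope X Y u v < slope X Y u' v)
    (ht : t < X v) : height X Y u' v t < height X Y u v t := by
  unfold height
  nlinarith

lemma height_eq_left {u v : V} (h : X u < X v) (t : ℝ) :
    height X Y u v t = Y u + slope X Y u v * (t - X u) := by
  have := height_left (Y := Y) h
  unfold height at *
  linarith

/-- A height on the segment is a convex combination of the heights of its ends. -/
lemma height_sub_le {u v : V} {c a t : ℝ} (hu : X u ≤ t) (hv : t < X v)
    (h1 : Y u - c * X u ≤ a) (h2 : Y v - c * X v ≤ a) : height X Y u v t - c * t ≤ a := by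
  have huv : X u < X v := by linarith
  have hl := height_left (Y := Y) huv
  unfold height at *
  rcases le_total (slope X Y u v) c with h | h
  · nlinarith
  · nlinarith

lemma le_height_sub {u v : V} {c a t : ℝ} (hu : X u ≤ t) (hv : t < X v)
    (h1 : a ≤ Y u - c * X u) (h2 : a ≤ Y v - c * X v) : a ≤ height X Y u v t - c * t := by
  have huv : X u < X v := by linarith
  have hl := height_left (Y := Y) huv
  unfold height at *
  rcases le_total (slope X Y u v) c with h | h
  · nlinarith
  · nlinarith

variable (X Y)

/-- A finite set of pairs of vertices, directed from left to right, that are the edges of a plane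
straight-line graph. -/
structure IsPlane (D : Finset (V × V)) : Prop where
  lt : ∀ {u v}, (u, v) ∈ D → X u < X v
  notMem : ∀ {u v w}, (u, v) ∈ D → X u < X w → X w < X v → Y w ≠ height X Y u v (X w)
  -- The conclusion is weak because the two edges may meet at a common end above `t`.
  noncrossing : ∀ {a b c d s t}, (a, b) ∈ D → (c, d) ∈ D → X a ≤ s → X c ≤ s → s < t →
    t ≤ X b → t ≤ X d → height X Y a b s < height X Y c d s →
    height X Y a b t ≤ height X Y c d t

/-- `uv` and `u'v` are edges that are consecutive at their right end `v`, with `u'v` below `uv`,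
and `w` is the rightmost vertex between them. -/
structure IsWedge (D : Finset (V × V)) (u v u' w : V) : Prop where
  upper : (u, v) ∈ D
  lower : (u', v) ∈ D
  slope_lt : slope X Y u v < slope X Y u' v
  consecutive : ∀ x, (x, v) ∈ D → slope X Y u v < slope X Y x v → slope X Y u' v ≤ slope X Y x v
  left_upper : X u ≤ X w
  left_lower : X u' ≤ X w
  right : X w < X v
  above : height X Y u' v (X w) ≤ Y w
  below : Y w ≤ height X Y u v (X w)
  outside : ∀ z, X w < X z → X z < X v →
    Y z < height X Y u' v (X z) ∨ height X Y u v (X z) < Y z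

variable {X Y} {D : Finset (V × V)}

/-- With equal slopes at a common right end, the left end closer to `v` would lie inside the other
edge. -/
lemma IsPlane.slope_injective (hD : IsPlane X Y D) (hX : Function.Injective X) {u u' v : V}
    (h : (u, v) ∈ D) (h' : (u', v) ∈ D) (hs : slope X Y u v = slope X Y u' v) : u = u' := by
  have key : ∀ {u u'}, (u, v) ∈ D → (u', v) ∈ D → slope X Y u v = slope X Y u' v →
      ¬ X u < X u' := by
    intro u u' h h' hs hlt
    apply hD.notMem h hlt (hD.lt h')
    rw [height, hs, ← height, height_left (hD.lt h')]
  exact hX (le_antisymm (not_lt.1 (key h' h hs.symm)) (not_lt.1 (key h h' hs)))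

lemma IsPlane.slope_injective' (hD : IsPlane X Y D) (hX : Function.Injective X) {u v v' : V}
    (h : (u, v) ∈ D) (h' : (u, v') ∈ D) (hs : slope X Y u v = slope X Y u v') : v = v' := by
  have key : ∀ {v v'}, (u, v) ∈ D → (u, v') ∈ D → slope X Y u v = slope X Y u v' →
      ¬ X v < X v' := by
    intro v v' h h' hs hlt
    apply hD.notMem h' (hD.lt h) hlt
    rw [height_eq_left (hD.lt h'), ← hs, ← height_eq_left (hD.lt h), height_right]
  exact hX (le_antisymm (not_lt.1 (key h' h hs.symm)) (not_lt.1 (key h h' hs)))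

/-- Among the steeper edges into `v`, the one of least slope is the next lower edge. The closed
region between the two edges contains both left ends, so its rightmost vertex before `v` exists and
lies weakly to the right of them. -/
lemma IsPlane.exists_isWedge [Fintype V] (hD : IsPlane X Y D) {u v x : V} (h : (u, v) ∈ D)
    (hx : (x, v) ∈ D) (hlt : slope X Y u v < slope X Y x v) : ∃ u' w, IsWedge X Y D u v u' w := by
  classical
  obtain ⟨u', hu', hmin⟩ := Finset.exists_min_image
    (Finset.univ.filter fun x => (x, v) ∈ D ∧ slope X Y u v < slope X Y x v)
    (fun x => slope X Y x v) ⟨x, by simp [hx, hlt]⟩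
  simp only [Finset.mem_filter, Finset.mem_univ, true_and] at hu' hmin
  have hmemu : X u < X v ∧ height X Y u' v (X u) ≤ Y u ∧ Y u ≤ height X Y u v (X u) :=
    ⟨hD.lt h, by
      have := height_lt_of_slope_lt hu'.2 (hD.lt h)
      rw [height_left (hD.lt h)] at this; exact this.le, (height_left (hD.lt h)).ge⟩
  have hmemu' : X u' < X v ∧ height X Y u' v (X u') ≤ Y u' ∧ Y u' ≤ height X Y u v (X u') :=
    ⟨hD.lt hu'.1, (height_left (hD.lt hu'.1)).le, by
      have := height_lt_of_slope_lt hu'.2 (hD.lt hu'.1)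
      rw [height_left (hD.lt hu'.1)] at this; exact this.le⟩
  obtain ⟨w, hw, hmax⟩ := Finset.exists_max_image
    (Finset.univ.filter fun w => X w < X v ∧ height X Y u' v (X w) ≤ Y w ∧
      Y w ≤ height X Y u v (X w)) X ⟨u, by simpa using hmemu⟩
  simp only [Finset.mem_filter, Finset.mem_univ, true_and] at hw hmax
  refine ⟨u', w, h, hu'.1, hu'.2, fun x hx hlt => hmin x ⟨hx, hlt⟩, hmax u hmemu, hmax u' hmemu',
    hw.1, hw.2.1, hw.2.2, fun z hz hzv => ?_⟩
  by_contra! hcon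
  exact absurd (hmax z ⟨hzv, hcon.1, hcon.2⟩) (not_le.2 hz)

lemma IsWedge.lt_height (hD : IsPlane X Y D) (hX : Function.Injective X) {u v u' w : V}
    (h : IsWedge X Y D u v u' w) (hne : w ≠ u) : Y w < height X Y u v (X w) :=
  lt_of_le_of_ne h.below
    (hD.notMem h.upper (lt_of_le_of_ne h.left_upper fun e => hne (hX e).symm) h.right)

/-- A vertex is the rightmost vertex of at most one wedge whose upper edge starts there. -/
lemma IsWedge.eq_of_left (hD : IsPlane X Y D) (hX : Function.Injective X) {w v v' x x' : V}
    (h : IsWedge X Y D w v x w) (h' : IsWedge X Y D w v' x' w) : v = v' := by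
  -- The edge `wv'`, if it left `w` below `wv`, would start inside the wedge at `v`. It cannot cross
  -- the lower edge: so either it passes `v` on the wrong side, or `v'` is a vertex of the wedge to
  -- the right of `w`.
  have key : ∀ {v v' x x'}, IsWedge X Y D w v x w → IsWedge X Y D w v' x' w →
      ¬ slope X Y w v' < slope X Y w v := by
    intro v v' x x' h h' hs
    have hcmp : ∀ t, X w < t → height X Y w v' t < height X Y w v t := by
      intro t ht
      rw [height_eq_left h.right, height_eq_left h'.right]
      nlinarith
    have hstart : height X Y x v (X w) < height X Y w v' (X w) := by
      have := height_lt_of_slope_lt h.slope_lt h.right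
      rwa [height_left h.right, ← height_left (Y := Y) h'.right] at this
    rcases le_or_gt (X v) (X v') with hle | hlt
    · have := hD.noncrossing h.lower h'.upper h.left_lower le_rfl h.right le_rfl hle hstart
      have h2 := hcmp (X v) h.right
      rw [height_right] at this h2
      linarith
    · have := hD.noncrossing h.lower h'.upper h.left_lower le_rfl h'.right hlt.le le_rfl hstart
      have h2 := hcmp (X v') h'.right
      rw [height_right] at this h2
      rcases h.outside v' h'.right hlt with h3 | h3 <;> linarith
  exact hD.slope_injective' hX h.upper h'.upper
    (le_antisymm (not_lt.1 (key h h')) (not_lt.1 (key h' h)))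

/-- A vertex is the rightmost vertex of at most one wedge whose upper edge lies above it. -/
lemma IsWedge.eq_of_below (hD : IsPlane X Y D) (hX : Function.Injective X)
    {u₁ u₂ v₁ v₂ x₁ x₂ w : V} (h₁ : IsWedge X Y D u₁ v₁ x₁ w) (h₂ : IsWedge X Y D u₂ v₂ x₂ w)
    (hw₁ : Y w < height X Y u₁ v₁ (X w)) (hw₂ : Y w < height X Y u₂ v₂ (X w)) :
    u₁ = u₂ ∧ v₁ = v₂ := by
  -- The nearer apex `v₁` is outside the second wedge. If it is below, the upper edge to `v₁`
  -- crosses the lower edge to `v₂`; if above, the lower edge to `v₁` crosses the upper edge to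
  -- `v₂`.
  have key : ∀ {u₁ u₂ v₁ v₂ x₁ x₂}, IsWedge X Y D u₁ v₁ x₁ w → IsWedge X Y D u₂ v₂ x₂ w →
      Y w < height X Y u₁ v₁ (X w) → Y w < height X Y u₂ v₂ (X w) → ¬ X v₁ < X v₂ := by
    intro u₁ u₂ v₁ v₂ x₁ x₂ h₁ h₂ hw₁ hw₂ hlt
    rcases h₂.outside v₁ h₁.right hlt with h | h
    · have := hD.noncrossing h₂.lower h₁.upper h₂.left_lower h₁.left_upper h₁.right hlt.le le_rfl
        (h₂.above.trans_lt hw₁)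
      rw [height_right] at this
      linarith
    · have := hD.noncrossing h₁.lower h₂.upper h₁.left_lower h₂.left_upper h₁.right le_rfl hlt.le
        (h₁.above.trans_lt hw₂)
      rw [height_right] at this
      linarith
  have hv : v₁ = v₂ := hX (le_antisymm (not_lt.1 (key h₂ h₁ hw₂ hw₁))
    (not_lt.1 (key h₁ h₂ hw₁ hw₂)))
  subst hv
  -- Wedges at the same apex are stacked: `w` lies on or above the lower edge of the upper wedge,
  -- hence not strictly below the upper edge of the other.
  have key' : ∀ {u₁ u₂ x₁ x₂}, IsWedge X Y D u₁ v₁ x₁ w → IsWedge X Y D u₂ v₁ x₂ w →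
      Y w < height X Y u₂ v₁ (X w) → ¬ slope X Y u₁ v₁ < slope X Y u₂ v₁ := by
    intro u₁ u₂ x₁ x₂ h₁ h₂ hw₂ hlt
    have h3 := h₁.consecutive u₂ h₂.upper hlt
    have h4 : height X Y u₂ v₁ (X w) ≤ height X Y x₁ v₁ (X w) := by
      have := h₁.right
      unfold height
      nlinarith
    linarith [h₁.above]
  exact ⟨hD.slope_injective hX h₁.upper h₂.upper
    (le_antisymm (not_lt.1 (key' h₂ h₁ hw₁)) (not_lt.1 (key' h₁ h₂ hw₂))), rfl⟩

/-- Of at least three points with distinct abscissas, one other than the leftmost point `l` and the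
rightmost point `r` maximizes or minimizes a linear functional `Y - c * X`. -/
lemma exists_extreme [Fintype V] (hn : 3 ≤ Fintype.card V) {l r : V}
    (hlr : X l < X r) : ∃ t c, t ≠ l ∧ t ≠ r ∧
      ((∀ z, Y z - c * X z ≤ Y t - c * X t) ∨ ∀ z, Y t - c * X t ≤ Y z - c * X z) := by
  classical
  -- With this slope the functional agrees at `l` and `r`, so only the side of the line `lr` on
  -- which another point lies matters.
  set c := slope X Y l r with hc
  have hl : Y l - c * X l = Y r - c * X r := by
    have := height_left (Y := Y) hlr
    unfold height at this
    linarith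
  have hne : ((Finset.univ : Finset V) \ {l, r}).Nonempty := by
    rw [← Finset.card_pos]
    have h1 := Finset.le_card_sdiff {l, r} (Finset.univ : Finset V)
    have h2 : ({l, r} : Finset V).card ≤ 2 := Finset.card_le_two
    rw [Finset.card_univ] at h1
    omega
  obtain ⟨t, ht, hmax⟩ := Finset.exists_max_image _ (fun z => Y z - c * X z) hne
  obtain ⟨b, hb, hmin⟩ := Finset.exists_min_image _ (fun z => Y z - c * X z) hne
  simp only [Finset.mem_sdiff, Finset.mem_univ, true_and, Finset.mem_insert,
    Finset.mem_singleton, not_or] at ht hb hmax hmin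
  rcases le_total (Y l - c * X l) (Y t - c * X t) with h | h
  · refine ⟨t, c, ht.1, ht.2, Or.inl fun z => ?_⟩
    by_cases hz : z = l ∨ z = r
    · rcases hz with rfl | rfl <;> linarith
    · exact hmax z (not_or.1 hz)
  · refine ⟨b, c, hb.1, hb.2, Or.inr fun z => ?_⟩
    have := hmax b hb
    by_cases hz : z = l ∨ z = r
    · rcases hz with rfl | rfl <;> linarith
    · exact hmin z (not_or.1 hz)

/-- A plane straight-line graph with `n ≥ 3` vertices has at most `3 * n - 6` edges. -/
theorem IsPlane.card_add_six_le [Fintype V] (hD : IsPlane X Y D) (hX : Function.Injective X)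
    (hn : 3 ≤ Fintype.card V) : D.card + 6 ≤ 3 * Fintype.card V := by
  classical
  have hne : (Finset.univ : Finset V).Nonempty := by
    rw [← Finset.card_pos, Finset.card_univ]; omega
  obtain ⟨l, -, hl⟩ := Finset.exists_min_image _ X hne
  obtain ⟨r, -, hr⟩ := Finset.exists_max_image _ X hne
  have hlr : X l < X r := by
    obtain ⟨a, b, hab⟩ := Fintype.one_lt_card_iff.1 (show 1 < Fintype.card V by omega)
    rcases lt_or_gt_of_ne (hX.ne hab) with h | h
    · exact ((hl a (by simp)).trans_lt h).trans_le (hr b (by simp))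
    · exact ((hl b (by simp)).trans_lt h).trans_le (hr a (by simp))
  obtain ⟨t, c, htl, htr, ht⟩ := exists_extreme (Y := Y) hn hlr
  -- The greatest slope means the lowest entering edge.
  set A := D.filter fun e => ∀ x, (x, e.2) ∈ D → slope X Y x e.2 ≤ slope X Y e.1 e.2 with hA
  have hex : ∀ e : V × V, e ∈ D → e ∉ A → ∃ q : V × V, IsWedge X Y D e.1 e.2 q.1 q.2 := by
    intro e he heA
    have : ∃ x, (x, e.2) ∈ D ∧ slope X Y e.1 e.2 < slope X Y x e.2 := by
      simpa [hA, he] using heA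
    obtain ⟨x, hx, hlt⟩ := this
    obtain ⟨u', w, h⟩ := hD.exists_isWedge (u := e.1) (v := e.2) he hx hlt
    exact ⟨(u', w), h⟩
  choose! q hq using hex
  set R := D \ A with hR
  have hq' : ∀ e ∈ R, IsWedge X Y D e.1 e.2 (q e).1 (q e).2 := fun e he =>
    hq e (Finset.mem_sdiff.1 he).1 (Finset.mem_sdiff.1 he).2
  set B := R.filter fun e => (q e).2 = e.1 with hB
  set C := R.filter fun e => ¬ (q e).2 = e.1 with hC
  have hcard : A.card + (B.card + C.card) = D.card := by
    rw [hB, hC, Finset.card_filter_add_card_filter_not, hR, add_comm]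
    exact Finset.card_sdiff_add_card_eq_card (Finset.filter_subset _ _)
  have hAcard : A.card ≤ (Finset.univ.erase l).card := by
    refine Finset.card_le_card_of_injOn Prod.snd ?_ ?_
    · intro e he
      have he' := (Finset.mem_filter.1 he).1
      simp only [Finset.coe_erase, Finset.coe_univ, Set.mem_sdiff, Set.mem_univ, true_and,
        Set.mem_singleton_iff]
      intro h
      have := hl e.1 (by simp)
      have := hD.lt (u := e.1) (v := e.2) he'
      rw [h] at this
      linarith
    · rintro ⟨u, v⟩ he ⟨u', v'⟩ he' (rfl : v = v')
      obtain ⟨h1, h2⟩ := Finset.mem_filter.1 he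
      obtain ⟨h3, h4⟩ := Finset.mem_filter.1 he'
      rw [hD.slope_injective hX h1 h3 (le_antisymm (h4 u h1) (h2 u' h3))]
  -- If `w = l`, both edges of the wedge start at `l` and have equal slopes; `w = r` fails because
  -- the apex is further right.
  have hmid : ∀ e ∈ R, (q e).2 ≠ l ∧ (q e).2 ≠ r := by
    intro e he
    have h := hq' e he
    refine ⟨fun hw => ?_, fun hw => ?_⟩
    · have h1 := h.left_upper
      have h2 := h.left_lower
      rw [hw] at h1 h2
      have h3 : e.1 = l := hX (le_antisymm h1 (hl _ (by simp)))
      have h4 : (q e).1 = l := hX (le_antisymm h2 (hl _ (by simp)))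
      have h5 := h.slope_lt
      rw [h3, h4] at h5
      exact lt_irrefl _ h5
    · have h1 := h.right
      rw [hw] at h1
      exact absurd (hr e.2 (by simp)) (not_le.2 h1)
  have hinjB : Set.InjOn (fun e => (q e).2) (B : Set (V × V)) := by
    intro e he e' he' (hee : (q e).2 = (q e').2)
    obtain ⟨h1, h2⟩ := Finset.mem_filter.1 he
    obtain ⟨h3, h4⟩ := Finset.mem_filter.1 he'
    have w1 := hq' e h1
    have w2 := hq' e' h3
    have h5 : e.1 = e'.1 := by rw [← h2, ← h4, hee]
    rw [h2] at w1
    rw [h4, ← h5] at w2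
    exact Prod.ext h5 (w1.eq_of_left hD hX w2)
  have hinjC : Set.InjOn (fun e => (q e).2) (C : Set (V × V)) := by
    intro e he e' he' (hee : (q e).2 = (q e').2)
    obtain ⟨h1, h2⟩ := Finset.mem_filter.1 he
    obtain ⟨h3, h4⟩ := Finset.mem_filter.1 he'
    have w1 := hq' e h1
    have w2 := hq' e' h3
    have b1 := w1.lt_height hD hX h2
    have b2 := w2.lt_height hD hX h4
    rw [← hee] at w2 b2
    have := w1.eq_of_below hD hX w2 b1 b2
    exact Prod.ext this.1 this.2
  have hcU : (Finset.univ.erase l : Finset V).card = Fintype.card V - 1 := by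
    rw [Finset.card_erase_of_mem (Finset.mem_univ _), Finset.card_univ]
  have hc2 : ((Finset.univ.erase l).erase r : Finset V).card = Fintype.card V - 2 := by
    rw [Finset.card_erase_of_mem (by simp [show r ≠ l by rintro rfl; exact lt_irrefl _ hlr]), hcU]
    omega
  have hc3 : (((Finset.univ.erase l).erase r).erase t : Finset V).card = Fintype.card V - 3 := by
    rw [Finset.card_erase_of_mem (by simp [htl, htr]), hc2]
    omega
  have hB2 : B.card ≤ Fintype.card V - 2 := by
    rw [← hc2]
    refine Finset.card_le_card_of_injOn _ (fun e he => ?_) hinjB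
    have := hmid e (Finset.mem_filter.1 he).1
    simp [this.1, this.2]
  have hC2 : C.card ≤ Fintype.card V - 2 := by
    rw [← hc2]
    refine Finset.card_le_card_of_injOn _ (fun e he => ?_) hinjC
    have := hmid e (Finset.mem_filter.1 he).1
    simp [this.1, this.2]
  -- A top vertex is never strictly below an edge, so it escapes `C`. A bottom vertex is never
  -- strictly above an edge, whereas a vertex charged by `B` is strictly above the lower edge of its
  -- wedge.
  rcases ht with ht | ht
  · have hC3 : C.card ≤ Fintype.card V - 3 := by
      rw [← hc3]
      refine Finset.card_le_card_of_injOn _ (fun e he => ?_) hinjC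
      obtain ⟨he1, he2⟩ := Finset.mem_filter.1 he
      have := hmid e he1
      have hw := hq' e he1
      have hb := hw.lt_height hD hX he2
      have htop : (q e).2 ≠ t := by
        rintro rfl
        have := height_sub_le hw.left_upper hw.right (ht e.1) (ht e.2)
        linarith
      simp [this.1, this.2, htop]
    omega
  · have hB3 : B.card ≤ Fintype.card V - 3 := by
      rw [← hc3]
      refine Finset.card_le_card_of_injOn _ (fun e he => ?_) hinjB
      obtain ⟨he1, he2⟩ := Finset.mem_filter.1 he
      have := hmid e he1
      have hw := hq' e he1
      have hbot : (q e).2 ≠ t := by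
        rintro rfl
        have h1 := le_height_sub hw.left_lower hw.right (ht (q e).1) (ht e.2)
        have h2 := height_lt_of_slope_lt hw.slope_lt hw.right
        have h3 := height_left (Y := Y) (hD.lt hw.upper)
        rw [← he2] at h2 h3
        linarith
      simp [this.1, this.2, hbot]
    omega

end PlaneGraph

/-! ### Coordinates in the plane -/

lemma mem_openSegment_iff_coord (a b z : Plane) : z ∈ openSegment ℝ a b ↔
    ∃ t : ℝ, 0 < t ∧ t < 1 ∧ z 0 = (1 - t) * a 0 + t * b 0 ∧ z 1 = (1 - t) * a 1 + t * b 1 := by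
  constructor
  · rintro ⟨s, t, hs, ht, hst, rfl⟩
    obtain rfl : s = 1 - t := by linarith
    exact ⟨t, ht, by linarith, by simp, by simp⟩
  · rintro ⟨t, h0, h1, hx, hy⟩
    refine ⟨1 - t, t, by linarith, h0, by ring, ?_⟩
    ext i
    fin_cases i
    · simpa using hx.symm
    · simpa using hy.symm

lemma Plane.inner_eq (a b : Plane) : ⟪a, b⟫_ℝ = a 0 * b 0 + a 1 * b 1 := by
  simp [PiLp.inner_apply, Fin.sum_univ_two]
  ring

/-! ### The upper bound on the number of edges -/

section UpperBound

open PlaneGraph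

variable {V : Type*} {G : SimpleGraph V} {p : V → Plane}

/-- Two crossing edges of a 0-bend apRAC drawing are perpendicular to different axes. -/
lemma IsApRACDrawing.exists_perp (h : IsApRACDrawing G p) {u v w z : V} (huv : G.Adj u v)
    (hwz : G.Adj w z) (hc : EdgesCross p u v w z) (i : Fin 2) : p u i = p v i ∨ p w i = p z i := by
  have h1 := h.axis_parallel huv hwz hc
  have h2 := h.right_angle huv hwz hc
  rw [Plane.inner_eq] at h2
  simp only [PiLp.sub_apply] at h2
  obtain ⟨h3 | h3, h4 | h4⟩ := h1
  · fin_cases i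
    · exact Or.inl h3
    · rw [h3, h4] at h2
      simp only [sub_self, zero_mul, zero_add, mul_eq_zero, sub_eq_zero] at h2
      exact h2.imp Eq.symm Eq.symm
  · fin_cases i
    · exact Or.inl h3
    · exact Or.inr h4
  · fin_cases i
    · exact Or.inr h4
    · exact Or.inl h3
  · fin_cases i
    · rw [h3, h4] at h2
      simp only [sub_self, mul_zero, add_zero, mul_eq_zero, sub_eq_zero] at h2
      exact h2.imp Eq.symm Eq.symm
    · exact Or.inl h3

/-- A shear of the plane makes the abscissas of finitely many points distinct. -/
lemma exists_shear_injective [Fintype V] (hp : Function.Injective p) :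
    ∃ c : ℝ, Function.Injective fun u => p u 0 + c * p u 1 := by
  classical
  -- The finite set holds every `c` for which two points of different ordinates collide. Pairs with
  -- equal ordinates contribute the value `0` of division by zero, which is harmless.
  obtain ⟨c, hc⟩ := Infinite.exists_notMem_finset ((Finset.univ : Finset (V × V)).image
    fun e => -(p e.1 0 - p e.2 0) / (p e.1 1 - p e.2 1))
  refine ⟨c, fun u v (huv : p u 0 + c * p u 1 = p v 0 + c * p v 1) => ?_⟩
  by_cases h : p u 1 = p v 1
  · apply hp
    ext i
    fin_cases i
    · rw [h] at huv
      simpa using huv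
    · exact h
  · refine absurd (Finset.mem_image.2 ⟨(u, v), Finset.mem_univ _, ?_⟩) hc
    have : p u 1 - p v 1 ≠ 0 := sub_ne_zero.2 h
    field_simp
    linarith

/-- The point of the sheared segment with a given abscissa. -/
lemma mem_openSegment_of_height {c : ℝ} {X : V → ℝ} (hX : ∀ u, X u = p u 0 + c * p u 1) {u v : V}
    {t : ℝ} (hu : X u < t) (hv : t < X v) {q : Plane} (hq : q 0 + c * q 1 = t)
    (hy : q 1 = height X (fun u => p u 1) u v t) : q ∈ openSegment ℝ (p u) (p v) := by
  have h : 0 < X v - X u := by linarith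
  have hy' : q 1 = (1 - (t - X u) / (X v - X u)) * p u 1 + (t - X u) / (X v - X u) * p v 1 := by
    rw [hy, height_eq_left (by linarith)]
    unfold PlaneGraph.slope
    field_simp
    ring
  refine (mem_openSegment_iff_coord _ _ _).2 ⟨(t - X u) / (X v - X u), by
    apply div_pos <;> linarith, by rw [div_lt_one h]; linarith, ?_, hy'⟩
  have hqx : q 0 = t - c * q 1 := by linarith
  have h1 : p u 0 = X u - c * p u 1 := by linarith [hX u]
  have h2 : p v 0 = X v - c * p v 1 := by linarith [hX v]
  rw [hqx, hy', h1, h2]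
  field_simp
  ring

lemma IsStraightLineDrawing.ne_height (h : IsStraightLineDrawing G p) {c : ℝ} {X : V → ℝ}
    (hX : ∀ u, X u = p u 0 + c * p u 1) {u v w : V} (huv : G.Adj u v) (h1 : X u < X w)
    (h2 : X w < X v) : p w 1 ≠ height X (fun u => p u 1) u v (X w) := by
  intro hy
  refine h.vertex_notMem (w := w) huv ?_ ?_
    (openSegment_subset_segment _ _ _ (mem_openSegment_of_height hX h1 h2 (hX w).symm hy))
  · rintro rfl; exact lt_irrefl _ h1
  · rintro rfl; exact lt_irrefl _ h2

variable [Fintype V]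

/-- The edges of a graph, directed by increasing `X`. -/
noncomputable def directedEdges (G : SimpleGraph V) (X : V → ℝ) : Finset (V × V) := by
  classical exact Finset.univ.filter fun e => G.Adj e.1 e.2 ∧ X e.1 < X e.2

lemma mem_directedEdges {X : V → ℝ} {e : V × V} :
    e ∈ directedEdges G X ↔ G.Adj e.1 e.2 ∧ X e.1 < X e.2 := by
  simp [directedEdges]

lemma ncard_edgeSet_eq_card_directedEdges {X : V → ℝ} (hX : Function.Injective X) :
    G.edgeSet.ncard = (directedEdges G X).card := by
  classical
  rw [← Set.ncard_coe_finset]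
  symm
  refine Set.ncard_congr (fun e _ => s(e.1, e.2)) ?_ ?_ ?_
  · intro e he
    exact (mem_directedEdges.1 he).1
  · rintro ⟨u, v⟩ ⟨u', v'⟩ h h' he
    have h := (mem_directedEdges.1 h).2
    have h' := (mem_directedEdges.1 h').2
    rcases Sym2.eq_iff.1 he with ⟨h1, h2⟩ | ⟨h1, h2⟩
    · exact Prod.ext h1 h2
    · simp only at h h' h1 h2
      rw [h1, h2] at h
      exact absurd h h'.not_gt
  · intro e he
    induction e using Sym2.ind with
    | _ u v =>
      rcases lt_or_gt_of_ne (hX.ne (SimpleGraph.Adj.ne he)) with h | h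
      · exact ⟨(u, v), mem_directedEdges.2 ⟨he, h⟩, rfl⟩
      · exact ⟨(v, u), mem_directedEdges.2 ⟨SimpleGraph.Adj.symm he, h⟩, Sym2.eq_swap⟩

/-- The edges that are not perpendicular to a given axis form a plane graph. -/
lemma IsApRACDrawing.isPlane (h : IsApRACDrawing G p) {c : ℝ} {X : V → ℝ}
    (hX : ∀ u, X u = p u 0 + c * p u 1) (i : Fin 2) :
    IsPlane X (fun u => p u 1) ((directedEdges G X).filter fun e => ¬ p e.1 i = p e.2 i) where
  lt he := (mem_directedEdges.1 (Finset.mem_filter.1 he).1).2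
  notMem he h1 h2 :=
    h.toIsStraightLineDrawing.ne_height hX (mem_directedEdges.1 (Finset.mem_filter.1 he).1).1 h1 h2
  noncrossing := by
    intro a b a' b' s t he he' has has' hst htb htb' hs
    obtain ⟨he, hi⟩ := Finset.mem_filter.1 he
    obtain ⟨he', hi'⟩ := Finset.mem_filter.1 he'
    obtain ⟨hadj, hlt⟩ := mem_directedEdges.1 he
    obtain ⟨hadj', hlt'⟩ := mem_directedEdges.1 he'
    by_contra! ht
    set f := fun r => height X (fun u => p u 1) a b r - height X (fun u => p u 1) a' b' r with hf
    have hcont : ContinuousOn f (Set.Icc s t) := by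
      simp only [hf, height]
      fun_prop
    -- A reversal of order forces a meeting strictly between `s` and `t`, hence in the interiors of
    -- both edges.
    obtain ⟨r, ⟨hr1, hr2⟩, hr⟩ := intermediate_value_Ioo hst.le hcont
      (show (0 : ℝ) ∈ Set.Ioo (f s) (f t) from ⟨by simp only [hf]; linarith,
        by simp only [hf]; linarith⟩)
    simp only [hf] at hr
    set q : Plane := !₂[r - c * height X (fun u => p u 1) a b r,
      height X (fun u => p u 1) a b r] with hq
    have hq0 : q 0 + c * q 1 = r := by simp [hq]
    have hq1 : q 1 = height X (fun u => p u 1) a b r := by simp [hq]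
    have m1 := mem_openSegment_of_height hX (has.trans_lt hr1) (hr2.trans_le htb) hq0 hq1
    have m2 := mem_openSegment_of_height hX (has'.trans_lt hr1) (hr2.trans_le htb') hq0
      (hq1.trans (sub_eq_zero.1 hr))
    have hne : s(a, b) ≠ s(a', b') := by
      intro heq
      rcases Sym2.eq_iff.1 heq with ⟨rfl, rfl⟩ | ⟨rfl, rfl⟩
      · exact lt_irrefl _ hs
      · exact lt_asymm hlt hlt'
    rcases h.exists_perp hadj hadj' ⟨hne, q, m1, m2⟩ i with h1 | h1
    · exact hi h1
    · exact hi' h1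

/-- The edges that are perpendicular to an axis form paths, one for each coordinate in use. -/
lemma IsStraightLineDrawing.card_perp_add_le [Nonempty V] (h : IsStraightLineDrawing G p) {c : ℝ}
    {X : V → ℝ} (hX : ∀ u, X u = p u 0 + c * p u 1) (hinj : Function.Injective X) (i : Fin 2) :
    ((directedEdges G X).filter fun e => p e.1 i = p e.2 i).card +
      (Finset.univ.image fun u => p u i).card ≤ Fintype.card V := by
  classical
  set H := (directedEdges G X).filter fun e => p e.1 i = p e.2 i with hH
  have hmem : ∀ {u v}, (u, v) ∈ H → G.Adj u v ∧ X u < X v ∧ p u i = p v i := by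
    intro u v he
    obtain ⟨he, hi⟩ := Finset.mem_filter.1 he
    obtain ⟨hadj, hlt⟩ := mem_directedEdges.1 he
    exact ⟨hadj, hlt, hi⟩
  -- Of two edges leaving `u` to the right along one line, the longer would pass through the end of
  -- the shorter.
  have key : ∀ {u v v'}, (u, v) ∈ H → (u, v') ∈ H → ¬ X v < X v' := by
    intro u v v' he he' hlt
    obtain ⟨h1, h2, h3⟩ := hmem he
    obtain ⟨h4, h5, h6⟩ := hmem he'
    refine h.ne_height hX h4 h2 hlt ?_
    rw [height_eq_left h5]
    have h7 : X v' - X u ≠ 0 := by linarith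
    unfold PlaneGraph.slope
    fin_cases i
    · simp only [Fin.zero_eta] at h3 h6
      have e1 : X v - X u = c * (p v 1 - p u 1) := by rw [hX, hX, h3]; ring
      have e2 : X v' - X u = c * (p v' 1 - p u 1) := by rw [hX, hX, h6]; ring
      rw [e2] at h7 ⊢
      rw [e1]
      have h8 : c ≠ 0 := left_ne_zero_of_mul h7
      have h9 : p v' 1 - p u 1 ≠ 0 := right_ne_zero_of_mul h7
      field_simp
      ring
    · simp only [Fin.mk_one] at h3 h6
      simp [← h3, ← h6]
  have hinjH : Set.InjOn Prod.fst (H : Set (V × V)) := by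
    rintro ⟨u, v⟩ he ⟨u', v'⟩ he' (rfl : u = u')
    rw [hinj (le_antisymm (not_lt.1 (key he' he)) (not_lt.1 (key he he')))]
  have hmax : ∀ y ∈ Finset.univ.image fun u => p u i,
      ∃ u, p u i = y ∧ ∀ v, p v i = y → X v ≤ X u := by
    intro y hy
    obtain ⟨u₀, -, hu₀⟩ := Finset.mem_image.1 hy
    obtain ⟨u, hu, hmax⟩ := Finset.exists_max_image (Finset.univ.filter fun u => p u i = y) X
      ⟨u₀, by simp [hu₀]⟩
    exact ⟨u, by simpa using hu, fun v hv => hmax v (by simp [hv])⟩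
  -- Edges inject into their left ends, and the rightmost vertex of each line is not a left end.
  choose! m hm1 hm2 using hmax
  rw [← Finset.card_image_of_injOn hinjH, ← Finset.card_image_of_injOn
    (f := m) (s := Finset.univ.image fun u => p u i)
    (fun y hy y' hy' hyy => by rw [← hm1 y hy, ← hm1 y' hy', hyy]), ← Finset.card_union_of_disjoint]
  · exact Finset.card_le_univ _
  · rw [Finset.disjoint_left]
    intro u hu hu'
    obtain ⟨⟨u₁, v⟩, he, rfl⟩ := Finset.mem_image.1 hu
    obtain ⟨y, hy, hyu⟩ := Finset.mem_image.1 hu'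
    obtain ⟨-, h2, h3⟩ := hmem he
    have h4 := hm1 y hy
    have h5 := hm2 y hy v
    simp only at hyu
    rw [hyu] at h4 h5
    exact absurd (h5 (h3.symm.trans h4)) (not_le.2 h2)

/-- A 0-bend apRAC graph with `n ≥ 3` vertices has at most `4 * n - √n - 6` edges. -/
theorem IsApRACGraph.ncard_edgeSet_le (hG : IsApRACGraph G) (hn : 3 ≤ Fintype.card V) :
    (G.edgeSet.ncard : ℝ) ≤ 4 * (Fintype.card V : ℝ) - √(Fintype.card V : ℝ) - 6 := by
  classical
  have : Nonempty V := Fintype.card_pos_iff.1 (by omega)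
  obtain ⟨p, h⟩ := hG
  obtain ⟨c, hc⟩ := exists_shear_injective h.injective
  set X : V → ℝ := fun u => p u 0 + c * p u 1 with hXdef
  have hX : ∀ u, X u = p u 0 + c * p u 1 := fun u => rfl
  set k : Fin 2 → ℕ := fun i => (Finset.univ.image fun u => p u i).card with hk
  have hbound : ∀ i, G.edgeSet.ncard + k i + 6 ≤ 4 * Fintype.card V := by
    intro i
    have h1 := (h.isPlane hX i).card_add_six_le hc hn
    have h2 := h.toIsStraightLineDrawing.card_perp_add_le hX hc i
    have h3 := Finset.card_filter_add_card_filter_not (s := directedEdges G X)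
      (fun e => p e.1 i = p e.2 i)
    rw [ncard_edgeSet_eq_card_directedEdges hc]
    simp only [hk]
    omega
  have hprod : Fintype.card V ≤ k 0 * k 1 := by
    rw [hk, ← Finset.card_product, ← Finset.card_univ]
    refine Finset.card_le_card_of_injOn (fun u => (p u 0, p u 1)) (fun u _ => by simp) ?_
    intro u _ v _ huv
    obtain ⟨h0, h1⟩ := Prod.mk.inj huv
    apply h.injective
    ext i
    fin_cases i
    · exact h0
    · exact h1
  obtain ⟨i, hi⟩ : ∃ i, Fintype.card V ≤ k i * k i := by
    rcases le_total (k 0) (k 1) with h01 | h01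
    · exact ⟨1, hprod.trans (Nat.mul_le_mul_right _ h01)⟩
    · exact ⟨0, hprod.trans (Nat.mul_le_mul_left _ h01)⟩
  have hs : √(Fintype.card V : ℝ) ≤ k i := by
    apply Real.sqrt_le_iff.2 ⟨by positivity, ?_⟩
    rw [sq]
    exact_mod_cast hi
  have hb : (G.edgeSet.ncard : ℝ) + k i + 6 ≤ 4 * Fintype.card V := by exact_mod_cast hbound i
  linarith

end UpperBound

/-! ### The drawing of the crossed grid with two apices -/

section ApexCrossedGrid

variable {k : ℕ}

lemma crossedGrid_adj_iff {a b : Fin k × Fin k} : (crossedGrid k).Adj a b ↔ a ≠ b ∧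
    ((a.1 : ℕ) ≤ b.1 + 1 ∧ (b.1 : ℕ) ≤ a.1 + 1) ∧ ((a.2 : ℕ) ≤ b.2 + 1 ∧ (b.2 : ℕ) ≤ a.2 + 1) := by
  simp only [crossedGrid, gridDiagonals, SimpleGraph.sup_adj, SimpleGraph.boxProd_adj,
    SimpleGraph.pathGraph_adj, ne_eq, Prod.ext_iff, Fin.ext_iff]
  omega

/-- The edges of the apex crossed grid, in one of their two directions. -/
def ApexEdge (k : ℕ) : (Fin k × Fin k) ⊕ Bool → (Fin k × Fin k) ⊕ Bool → Prop
  | .inl a, .inl b => (crossedGrid k).Adj a b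
  | .inl a, .inr true => (a.1 : ℕ) + 1 = k ∨ (a.2 : ℕ) + 1 = k
  | .inl a, .inr false => (a.1 : ℕ) = 0 ∨ (a.2 : ℕ) = 0
  | .inr true, .inr false => True
  | _, _ => False

lemma apexCrossedGrid_adj {x y : (Fin k × Fin k) ⊕ Bool} :
    (apexCrossedGrid k).Adj x y ↔ x ≠ y ∧ (ApexEdge k x y ∨ ApexEdge k y x) := by
  refine (SimpleGraph.fromRel_adj _ _ _).trans ?_
  rcases x with a | _ | _ <;> rcases y with b | _ | _ <;> rfl

/-- A drawing of the apex crossed grid: the grid is rotated by `π / 4`, so that the diagonals of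
its faces become axis-parallel. -/
noncomputable def apexDrawing (k : ℕ) : (Fin k × Fin k) ⊕ Bool → Plane
  | .inl a => !₂[(a.1 : ℝ) - (a.2 : ℝ), (a.1 : ℝ) + (a.2 : ℝ)]
  | .inr true => !₂[(k : ℝ), 3 * k]
  | .inr false => !₂[(k : ℝ), -2 - k]

@[simp] lemma apexDrawing_inl_zero (a : Fin k × Fin k) :
    apexDrawing k (.inl a) 0 = (a.1 : ℝ) - (a.2 : ℝ) := rfl
@[simp] lemma apexDrawing_inl_one (a : Fin k × Fin k) :
    apexDrawing k (.inl a) 1 = (a.1 : ℝ) + (a.2 : ℝ) := rfl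
@[simp] lemma apexDrawing_north_zero : apexDrawing k (.inr true) 0 = k := rfl
@[simp] lemma apexDrawing_north_one : apexDrawing k (.inr true) 1 = 3 * k := rfl
@[simp] lemma apexDrawing_south_zero : apexDrawing k (.inr false) 0 = k := rfl
@[simp] lemma apexDrawing_south_one : apexDrawing k (.inr false) 1 = -2 - k := rfl

/-- The region of the plane that contains the crossed grid. -/
def gridRegion (k : ℕ) : Set Plane :=
  {z | 0 ≤ z 1 + z 0 ∧ z 1 + z 0 ≤ 2 * (k - 1) ∧ 0 ≤ z 1 - z 0 ∧ z 1 - z 0 ≤ 2 * (k - 1)}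

/-- The region of the plane that contains the edges from the grid to `N`. -/
def northRegion (k : ℕ) : Set Plane :=
  {z | z 0 < k ∧ (2 * ((k : ℝ) - 1) < z 1 + z 0 ∨ 2 * ((k : ℝ) - 1) < z 1 - z 0)}

/-- The region of the plane that contains the edges from the grid to `S`. -/
def southRegion (k : ℕ) : Set Plane :=
  {z | z 0 < k ∧ z 1 + z 0 < 2 * (k - 1) ∧ z 1 - z 0 < 2 * (k - 1) ∧
    (z 1 + z 0 < 0 ∨ z 1 - z 0 < 0)}

lemma Fin.cast_le_sub_one (i : Fin k) : ((i : ℕ) : ℝ) ≤ k - 1 := by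
  have h : ((i : ℕ) : ℝ) + 1 ≤ k := by exact_mod_cast i.2
  linarith

lemma apexDrawing_inl_mem (a : Fin k × Fin k) : apexDrawing k (.inl a) ∈ gridRegion k := by
  have h1 := Fin.cast_le_sub_one a.1
  have h2 := Fin.cast_le_sub_one a.2
  have h3 : (0 : ℝ) ≤ (a.1 : ℕ) := Nat.cast_nonneg _
  have h4 : (0 : ℝ) ≤ (a.2 : ℕ) := Nat.cast_nonneg _
  simp only [gridRegion, Set.mem_ofPred_eq, apexDrawing_inl_zero, apexDrawing_inl_one]
  refine ⟨?_, ?_, ?_, ?_⟩ <;> linarith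

lemma mem_gridRegion {a b : Fin k × Fin k} {z : Plane}
    (hz : z ∈ openSegment ℝ (apexDrawing k (.inl a)) (apexDrawing k (.inl b))) :
    z ∈ gridRegion k := by
  obtain ⟨t, h0, h1, e0, e1⟩ := (mem_openSegment_iff_coord _ _ _).1 hz
  obtain ⟨a1, a2, a3, a4⟩ := apexDrawing_inl_mem a
  obtain ⟨b1, b2, b3, b4⟩ := apexDrawing_inl_mem b
  have h1' : 0 ≤ 1 - t := by linarith
  simp only [gridRegion, Set.mem_ofPred_eq]
  rw [e0, e1]
  refine ⟨?_, ?_, ?_, ?_⟩ <;> nlinarith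

/-- On the grid, the sum and the difference of ordinate and abscissa are `2i` and `2j`. At `N` they
are `4k` and `2k`, both beyond the maximum `2(k - 1)`, so a segment from an extreme side leaves the
square at once. -/
lemma mem_northRegion {a : Fin k × Fin k} (ha : (a.1 : ℕ) + 1 = k ∨ (a.2 : ℕ) + 1 = k) {z : Plane}
    (hz : z ∈ openSegment ℝ (apexDrawing k (.inl a)) (apexDrawing k (.inr true))) :
    z ∈ northRegion k := by
  obtain ⟨t, h0, h1, e0, e1⟩ := (mem_openSegment_iff_coord _ _ _).1 hz
  obtain ⟨a1, a2, a3, a4⟩ := apexDrawing_inl_mem a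
  simp only [apexDrawing_inl_zero, apexDrawing_inl_one, apexDrawing_north_zero,
    apexDrawing_north_one] at *
  have h1' : 0 < 1 - t := by linarith
  simp only [northRegion, Set.mem_ofPred_eq]
  rw [e0, e1]
  refine ⟨by nlinarith, ?_⟩
  rcases ha with ha | ha
  · left
    have : ((a.1 : ℕ) : ℝ) = k - 1 := eq_sub_of_add_eq (by exact_mod_cast ha)
    rw [this]
    nlinarith
  · right
    have : ((a.2 : ℕ) : ℝ) = k - 1 := eq_sub_of_add_eq (by exact_mod_cast ha)
    rw [this]
    nlinarith

/-- At `S` the values of `2i` and `2j` become `-2` and `-2 - 2k`, both negative. The two upper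
bounds keep the region away from the north one. -/
lemma mem_southRegion {a : Fin k × Fin k} (ha : (a.1 : ℕ) = 0 ∨ (a.2 : ℕ) = 0) {z : Plane}
    (hz : z ∈ openSegment ℝ (apexDrawing k (.inl a)) (apexDrawing k (.inr false))) :
    z ∈ southRegion k := by
  obtain ⟨t, h0, h1, e0, e1⟩ := (mem_openSegment_iff_coord _ _ _).1 hz
  obtain ⟨a1, a2, a3, a4⟩ := apexDrawing_inl_mem a
  simp only [apexDrawing_inl_zero, apexDrawing_inl_one, apexDrawing_south_zero,
    apexDrawing_south_one] at *
  have h1' : 0 < 1 - t := by linarith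
  simp only [southRegion, Set.mem_ofPred_eq]
  rw [e0, e1]
  refine ⟨by nlinarith, by nlinarith, by nlinarith, ?_⟩
  rcases ha with ha | ha
  · left
    have : ((a.1 : ℕ) : ℝ) = 0 := by exact_mod_cast ha
    rw [this]
    nlinarith
  · right
    have : ((a.2 : ℕ) : ℝ) = 0 := by exact_mod_cast ha
    rw [this]
    nlinarith

lemma apply_zero_of_mem_north_south {z : Plane}
    (hz : z ∈ openSegment ℝ (apexDrawing k (.inr true)) (apexDrawing k (.inr false))) :
    z 0 = k := by
  obtain ⟨t, h0, h1, e0, e1⟩ := (mem_openSegment_iff_coord _ _ _).1 hz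
  rw [e0, apexDrawing_north_zero, apexDrawing_south_zero]
  ring

lemma gridRegion_apply_zero_lt {z : Plane} (hz : z ∈ gridRegion k) : z 0 < k := by
  obtain ⟨h1, h2, h3, h4⟩ := hz
  linarith

lemma disjoint_grid_north {z : Plane} (h : z ∈ gridRegion k) (h' : z ∈ northRegion k) : False := by
  obtain ⟨h1, h2, h3, h4⟩ := h
  obtain ⟨h5, h6 | h6⟩ := h' <;> linarith

lemma disjoint_grid_south {z : Plane} (h : z ∈ gridRegion k) (h' : z ∈ southRegion k) : False := by
  obtain ⟨h1, h2, h3, h4⟩ := h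
  obtain ⟨h5, h6, h7, h8 | h8⟩ := h' <;> linarith

lemma disjoint_north_south {z : Plane} (h : z ∈ northRegion k) (h' : z ∈ southRegion k) :
    False := by
  obtain ⟨h5, h6, h7, -⟩ := h'
  obtain ⟨-, h8 | h8⟩ := h <;> linarith

/-- The position of a point of a segment with integral ends at distance at most one. -/
lemma exists_floor_segment {a b : ℕ} (h1 : a ≤ b + 1) (h2 : b ≤ a + 1) {t : ℝ} (h0 : 0 < t)
    (ht : t < 1) : ∃ m : ℕ, (a = m ∧ b = m ∧ (1 - t) * a + t * b = (m : ℝ)) ∨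
      ((a = m ∧ b = m + 1 ∨ a = m + 1 ∧ b = m) ∧ (m : ℝ) < (1 - t) * a + t * b ∧
        (1 - t) * a + t * b < (m : ℝ) + 1) := by
  obtain rfl | rfl | rfl : a = b ∨ b = a + 1 ∨ a = b + 1 := by omega
  · exact ⟨a, Or.inl ⟨rfl, rfl, by ring⟩⟩
  · refine ⟨a, Or.inr ⟨Or.inl ⟨rfl, rfl⟩, ?_, ?_⟩⟩ <;> push_cast <;> nlinarith
  · refine ⟨b, Or.inr ⟨Or.inr ⟨rfl, rfl⟩, ?_, ?_⟩⟩ <;> push_cast <;> nlinarith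

/-- An interior point of a unit interval determines the interval, and an integer value forces a
degenerate one; only the direction remains free. -/
lemma ends_eq_of_segment_eq {a b c d : ℕ} (h1 : a ≤ b + 1) (h2 : b ≤ a + 1) (h3 : c ≤ d + 1)
    (h4 : d ≤ c + 1) {s t : ℝ} (hs0 : 0 < s) (hs : s < 1) (ht0 : 0 < t) (ht : t < 1)
    (h : (1 - s) * a + s * b = (1 - t) * c + t * d) : a = c ∧ b = d ∨ a = d ∧ b = c := by
  obtain ⟨m, hm⟩ := exists_floor_segment h1 h2 hs0 hs
  obtain ⟨n, hn⟩ := exists_floor_segment h3 h4 ht0 ht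
  rw [h] at hm
  rcases hm with ⟨m1, m2, m3⟩ | ⟨m1, m2, m3⟩ <;> rcases hn with ⟨n1, n2, n3⟩ | ⟨n1, n2, n3⟩
  · have : m = n := by exact_mod_cast m3.symm.trans n3
    omega
  · rw [m3] at n2 n3
    norm_cast at n2 n3
    omega
  · rw [n3] at m2 m3
    norm_cast at m2 m3
    omega
  · have e1 : (m : ℝ) < n + 1 := m2.trans n3
    have e2 : (n : ℝ) < m + 1 := n2.trans m3
    norm_cast at e1 e2
    omega

/-- Crossed grid edges with a common interior point have the same projections. -/
lemma crossedGrid_ends_eq {a b c d : Fin k × Fin k}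
    (hab : ((a.1 : ℕ) ≤ b.1 + 1 ∧ (b.1 : ℕ) ≤ a.1 + 1) ∧
      ((a.2 : ℕ) ≤ b.2 + 1 ∧ (b.2 : ℕ) ≤ a.2 + 1))
    (hcd : ((c.1 : ℕ) ≤ d.1 + 1 ∧ (d.1 : ℕ) ≤ c.1 + 1) ∧
      ((c.2 : ℕ) ≤ d.2 + 1 ∧ (d.2 : ℕ) ≤ c.2 + 1)) {z : Plane}
    (hz : z ∈ openSegment ℝ (apexDrawing k (.inl a)) (apexDrawing k (.inl b)))
    (hz' : z ∈ openSegment ℝ (apexDrawing k (.inl c)) (apexDrawing k (.inl d))) :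
    (a.1 = c.1 ∧ b.1 = d.1 ∨ a.1 = d.1 ∧ b.1 = c.1) ∧
      (a.2 = c.2 ∧ b.2 = d.2 ∨ a.2 = d.2 ∧ b.2 = c.2) := by
  obtain ⟨s, s0, s1, e0, e1⟩ := (mem_openSegment_iff_coord _ _ _).1 hz
  obtain ⟨t, t0, t1, e2, e3⟩ := (mem_openSegment_iff_coord _ _ _).1 hz'
  simp only [apexDrawing_inl_zero, apexDrawing_inl_one] at e0 e1 e2 e3
  simp only [Fin.ext_iff]
  exact ⟨ends_eq_of_segment_eq hab.1.1 hab.1.2 hcd.1.1 hcd.1.2 s0 s1 t0 t1 (by linarith),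
    ends_eq_of_segment_eq hab.2.1 hab.2.2 hcd.2.1 hcd.2.2 s0 s1 t0 t1 (by linarith)⟩

lemma apexDrawing_injective : Function.Injective (apexDrawing k) := by
  intro x y h
  have h0 : apexDrawing k x 0 = apexDrawing k y 0 := by rw [h]
  have h1 : apexDrawing k x 1 = apexDrawing k y 1 := by rw [h]
  have hk : (0 : ℝ) ≤ k := Nat.cast_nonneg _
  have hin : ∀ a : Fin k × Fin k, apexDrawing k (.inl a) 0 < k := fun a =>
    gridRegion_apply_zero_lt (apexDrawing_inl_mem a)
  rcases x with a | _ | _ <;> rcases y with b | _ | _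
  · simp only [apexDrawing_inl_zero, apexDrawing_inl_one] at h0 h1
    have e1 : ((a.1 : ℕ) : ℝ) = (b.1 : ℕ) := by linarith
    have e2 : ((a.2 : ℕ) : ℝ) = (b.2 : ℕ) := by linarith
    exact congrArg _ (Prod.ext (Fin.ext (by exact_mod_cast e1)) (Fin.ext (by exact_mod_cast e2)))
  · exact absurd h0 (hin a).ne
  · exact absurd h0 (hin a).ne
  · exact absurd h0 (hin b).ne'
  · rfl
  · simp only [apexDrawing_north_one, apexDrawing_south_one] at h1
    linarith
  · exact absurd h0 (hin b).ne'
  · simp only [apexDrawing_north_one, apexDrawing_south_one] at h1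
    linarith
  · rfl

/-- Segments with a common end that share an interior point are nested. -/
lemma nested_of_openSegment {a b c z : Plane} (ha : z ∈ openSegment ℝ a c)
    (hb : z ∈ openSegment ℝ b c) : a = b ∨ a ∈ openSegment ℝ b c ∨ b ∈ openSegment ℝ a c := by
  have key : ∀ {a b : Plane} {s t : ℝ}, s < t → t < 1 →
      z 0 = (1 - s) * a 0 + s * c 0 → z 1 = (1 - s) * a 1 + s * c 1 →
      z 0 = (1 - t) * b 0 + t * c 0 → z 1 = (1 - t) * b 1 + t * c 1 →
      a ∈ openSegment ℝ b c := by
    intro a b s t hst ht e0 e1 e2 e3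
    have hs : 0 < 1 - s := by linarith
    refine (mem_openSegment_iff_coord _ _ _).2 ⟨(t - s) / (1 - s), div_pos (by linarith) hs,
      by rw [div_lt_one hs]; linarith, ?_, ?_⟩
    · field_simp
      linarith
    · field_simp
      linarith
  obtain ⟨s, s0, s1, e0, e1⟩ := (mem_openSegment_iff_coord _ _ _).1 ha
  obtain ⟨t, t0, t1, e2, e3⟩ := (mem_openSegment_iff_coord _ _ _).1 hb
  rcases lt_trichotomy s t with h | rfl | h
  · exact Or.inr (Or.inl (key h t1 e0 e1 e2 e3))
  · left
    have hs : 1 - s ≠ 0 := by linarith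
    ext i
    apply mul_left_cancel₀ hs
    fin_cases i
    · simp only [Fin.zero_eta]
      linarith
    · simp only [Fin.mk_one]
      linarith
  · exact Or.inr (Or.inr (key h s1 e2 e3 e0 e1))

lemma ApexEdge.notMem_openSegment {u v w : (Fin k × Fin k) ⊕ Bool} (huv : ApexEdge k u v)
    (hne : u ≠ v) (hwv : w ≠ v) :
    apexDrawing k w ∉ openSegment ℝ (apexDrawing k u) (apexDrawing k v) := by
  intro hz
  have hapex : ∀ b, apexDrawing k (.inr b) 0 = k := by rintro (_ | _) <;> rfl
  rcases u with a | _ | _ <;> rcases v with b | _ | _ <;> simp only [ApexEdge] at huv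
  · rcases w with c | c
    · obtain ⟨h1, h2⟩ := crossedGrid_adj_iff.1 huv
      obtain ⟨t, h0, h1', e0, e1⟩ := (mem_openSegment_iff_coord _ _ _).1 hz
      simp only [apexDrawing_inl_zero, apexDrawing_inl_one] at e0 e1
      -- The vertex `c` is treated as a degenerate edge, which forces both projections of the edge
      -- to be constant.
      have h3 := ends_eq_of_segment_eq (c := c.1) (d := c.1) h2.1.1 h2.1.2 (by omega) (by omega) h0
        h1' h0 h1' (by linarith)
      have h4 := ends_eq_of_segment_eq (c := c.2) (d := c.2) h2.2.1 h2.2.2 (by omega) (by omega) h0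
        h1' h0 h1' (by linarith)
      exact h1 (Prod.ext (Fin.ext (by omega)) (Fin.ext (by omega)))
    · exact absurd (hapex c) (gridRegion_apply_zero_lt (mem_gridRegion hz)).ne
  · rcases w with c | c
    · exact disjoint_grid_south (apexDrawing_inl_mem c) (mem_southRegion huv hz)
    · exact absurd (hapex c) (mem_southRegion huv hz).1.ne
  · rcases w with c | c
    · exact disjoint_grid_north (apexDrawing_inl_mem c) (mem_northRegion huv hz)
    · exact absurd (hapex c) (mem_northRegion huv hz).1.ne
  · rcases w with c | _ | _
    · exact absurd (apply_zero_of_mem_north_south hz)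
        (gridRegion_apply_zero_lt (apexDrawing_inl_mem c)).ne
    · exact hwv rfl
    · have := apexDrawing_injective.ne hne
      exact this (left_mem_openSegment_iff.1 hz)

/-- What the definition of an apRAC drawing asks of two crossing edges. -/
def CrossNicely (p : Plane) (q : Plane) (p' : Plane) (q' : Plane) : Prop :=
  ⟪q - p, q' - p'⟫_ℝ = 0 ∧ IsAxisParallel p q ∧ IsAxisParallel p' q'

lemma IsAxisParallel.symm {p q : Plane} (h : IsAxisParallel p q) : IsAxisParallel q p :=
  h.imp Eq.symm Eq.symm

lemma CrossNicely.swap_left {p q p' q' : Plane} (h : CrossNicely p q p' q') :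
    CrossNicely q p p' q' := by
  refine ⟨?_, h.2.1.symm, h.2.2⟩
  rw [← neg_sub q p, inner_neg_left, h.1, neg_zero]

lemma CrossNicely.swap_right {p q p' q' : Plane} (h : CrossNicely p q p' q') :
    CrossNicely p q q' p' := by
  refine ⟨?_, h.2.1, h.2.2.symm⟩
  rw [← neg_sub q' p', inner_neg_right, h.1, neg_zero]

/-- Both projections of the two edges coincide as unordered pairs. If one projection were constant,
the edges would be equal; so they are the two diagonals of one face, with exactly one projection
reversed. -/
lemma crossNicely_of_crossedGrid {a b c d : Fin k × Fin k} (hab : (crossedGrid k).Adj a b)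
    (hcd : (crossedGrid k).Adj c d)
    (h : EdgesCross (apexDrawing k) (.inl a) (.inl b) (.inl c) (.inl d)) :
    CrossNicely (apexDrawing k (.inl a)) (apexDrawing k (.inl b))
      (apexDrawing k (.inl c)) (apexDrawing k (.inl d)) := by
  obtain ⟨hne, z, hz, hz'⟩ := h
  obtain ⟨h1, h2⟩ := crossedGrid_adj_iff.1 hab
  obtain ⟨h3, h4⟩ := crossedGrid_adj_iff.1 hcd
  have he := crossedGrid_ends_eq h2 h4 hz hz'
  have hdiag : ∀ {a b : ℕ}, a ≠ b → a ≤ b + 1 → b ≤ a + 1 → ((b : ℝ) - a) ^ 2 = 1 := by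
    intro a b hab h1 h2
    obtain rfl | rfl : b = a + 1 ∨ a = b + 1 := by omega
    · push_cast; ring
    · push_cast; ring
  have hab1 : a.1 ≠ b.1 := by
    intro e
    apply hne
    obtain ⟨he1, ⟨e3, e4⟩ | ⟨e3, e4⟩⟩ := he
    · rw [show a = c from Prod.ext (by rcases he1 with h | h <;> simp_all) e3,
        show b = d from Prod.ext (by rcases he1 with h | h <;> simp_all) e4]
    · rw [show a = d from Prod.ext (by rcases he1 with h | h <;> simp_all) e3,
        show b = c from Prod.ext (by rcases he1 with h | h <;> simp_all) e4, Sym2.eq_swap]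
  have hab2 : a.2 ≠ b.2 := by
    intro e
    apply hne
    obtain ⟨⟨e3, e4⟩ | ⟨e3, e4⟩, he1⟩ := he
    · rw [show a = c from Prod.ext e3 (by rcases he1 with h | h <;> simp_all),
        show b = d from Prod.ext e4 (by rcases he1 with h | h <;> simp_all)]
    · rw [show a = d from Prod.ext e3 (by rcases he1 with h | h <;> simp_all),
        show b = c from Prod.ext e4 (by rcases he1 with h | h <;> simp_all), Sym2.eq_swap]
  have q1 := hdiag (Fin.val_injective.ne hab1) h2.1.1 h2.1.2
  have q2 := hdiag (Fin.val_injective.ne hab2) h2.2.1 h2.2.2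
  -- The factors are the coordinate increments in the rotated drawing, so their vanishing product
  -- says that the edge is axis-parallel.
  have hfac : (((b.1 : ℕ) : ℝ) - (a.1 : ℕ) - ((b.2 : ℕ) - (a.2 : ℕ))) *
      ((b.1 : ℕ) - (a.1 : ℕ) + ((b.2 : ℕ) - (a.2 : ℕ))) = 0 := by linarith
  simp only [CrossNicely, Plane.inner_eq, IsAxisParallel, PiLp.sub_apply, apexDrawing_inl_zero,
    apexDrawing_inl_one]
  obtain ⟨⟨e1, e2⟩ | ⟨e1, e2⟩, ⟨e3, e4⟩ | ⟨e3, e4⟩⟩ := he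
  · exact absurd (by rw [Prod.ext e1 e3, Prod.ext e2 e4]) hne
  · rw [← e1, ← e2, ← e3, ← e4]
    refine ⟨by linarith, ?_, ?_⟩ <;> rcases mul_eq_zero.1 hfac with h | h
    · exact Or.inl (by linarith)
    · exact Or.inr (by linarith)
    · exact Or.inr (by linarith)
    · exact Or.inl (by linarith)
  · rw [← e1, ← e2, ← e3, ← e4]
    refine ⟨by linarith, ?_, ?_⟩ <;> rcases mul_eq_zero.1 hfac with h | h
    · exact Or.inl (by linarith)
    · exact Or.inr (by linarith)
    · exact Or.inr (by linarith)
    · exact Or.inl (by linarith)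
  · exact absurd (by rw [Prod.ext (x := a) (y := d) e1 e3, Prod.ext (x := b) (y := c) e2 e4,
      Sym2.eq_swap]) hne

/-- Two edges from the grid to the same apex do not cross. -/
lemma not_edgesCross_fan {a b : Fin k × Fin k} {q : Bool} {R : Set Plane}
    (hR : ∀ z ∈ gridRegion k, z ∉ R)
    (ha : openSegment ℝ (apexDrawing k (.inl a)) (apexDrawing k (.inr q)) ⊆ R)
    (hb : openSegment ℝ (apexDrawing k (.inl b)) (apexDrawing k (.inr q)) ⊆ R) :
    ¬ EdgesCross (apexDrawing k) (.inl a) (.inr q) (.inl b) (.inr q) := by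
  rintro ⟨hne, z, hz, hz'⟩
  rcases nested_of_openSegment hz hz' with h | h | h
  · exact hne (by rw [apexDrawing_injective h])
  · exact hR _ (apexDrawing_inl_mem a) (hb h)
  · exact hR _ (apexDrawing_inl_mem b) (ha h)

lemma ApexEdge.crossNicely {u v w z : (Fin k × Fin k) ⊕ Bool} (huv : ApexEdge k u v)
    (hwz : ApexEdge k w z) (h : EdgesCross (apexDrawing k) u v w z) :
    CrossNicely (apexDrawing k u) (apexDrawing k v) (apexDrawing k w) (apexDrawing k z) := by
  have h' := h
  obtain ⟨hne, x, hx, hx'⟩ := h'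
  rcases u with a | _ | _ <;> rcases v with b | _ | _ <;> simp only [ApexEdge] at huv <;>
    rcases w with c | _ | _ <;> rcases z with d | _ | _ <;> simp only [ApexEdge] at hwz
  · exact crossNicely_of_crossedGrid huv hwz h
  · exact (disjoint_grid_south (mem_gridRegion hx) (mem_southRegion hwz hx')).elim
  · exact (disjoint_grid_north (mem_gridRegion hx) (mem_northRegion hwz hx')).elim
  · exact absurd (apply_zero_of_mem_north_south hx')
      (gridRegion_apply_zero_lt (mem_gridRegion hx)).ne
  · exact (disjoint_grid_south (mem_gridRegion hx') (mem_southRegion huv hx)).elim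
  · exact (not_edgesCross_fan (fun _ => disjoint_grid_south) (fun _ => mem_southRegion huv)
      (fun _ => mem_southRegion hwz) h).elim
  · exact (disjoint_north_south (mem_northRegion hwz hx') (mem_southRegion huv hx)).elim
  · exact absurd (apply_zero_of_mem_north_south hx') (mem_southRegion huv hx).1.ne
  · exact (disjoint_grid_north (mem_gridRegion hx') (mem_northRegion huv hx)).elim
  · exact (disjoint_north_south (mem_northRegion huv hx) (mem_southRegion hwz hx')).elim
  · exact (not_edgesCross_fan (fun _ => disjoint_grid_north) (fun _ => mem_northRegion huv)
      (fun _ => mem_northRegion hwz) h).elim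
  · exact absurd (apply_zero_of_mem_north_south hx') (mem_northRegion huv hx).1.ne
  · exact absurd (apply_zero_of_mem_north_south hx)
      (gridRegion_apply_zero_lt (mem_gridRegion hx')).ne
  · exact absurd (apply_zero_of_mem_north_south hx) (mem_southRegion hwz hx').1.ne
  · exact absurd (apply_zero_of_mem_north_south hx) (mem_northRegion hwz hx').1.ne
  · exact absurd rfl hne

lemma EdgesCross.swap_left {V : Type*} {p : V → Plane} {u v w z : V} (h : EdgesCross p u v w z) :
    EdgesCross p v u w z := by
  unfold EdgesCross at *
  rwa [Sym2.eq_swap, openSegment_symm]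

lemma EdgesCross.swap_right {V : Type*} {p : V → Plane} {u v w z : V} (h : EdgesCross p u v w z) :
    EdgesCross p u v z w := by
  unfold EdgesCross at *
  rwa [Sym2.eq_swap (a := z), openSegment_symm ℝ (p z)]

lemma apexCrossedGrid_crossNicely {u v w z : (Fin k × Fin k) ⊕ Bool}
    (huv : (apexCrossedGrid k).Adj u v) (hwz : (apexCrossedGrid k).Adj w z)
    (h : EdgesCross (apexDrawing k) u v w z) :
    CrossNicely (apexDrawing k u) (apexDrawing k v) (apexDrawing k w) (apexDrawing k z) := by
  rcases (apexCrossedGrid_adj.1 huv).2 with h1 | h1 <;>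
    rcases (apexCrossedGrid_adj.1 hwz).2 with h2 | h2
  · exact h1.crossNicely h2 h
  · exact (h1.crossNicely h2 h.swap_right).swap_right
  · exact (h1.crossNicely h2 h.swap_left).swap_left
  · exact (h1.crossNicely h2 h.swap_left.swap_right).swap_left.swap_right

theorem apexDrawing_isApRACDrawing (k : ℕ) :
    IsApRACDrawing (apexCrossedGrid k) (apexDrawing k) where
  injective := apexDrawing_injective
  vertex_notMem := by
    intro u v w huv hwu hwv hmem
    have hopen := mem_openSegment_of_ne_left_right (apexDrawing_injective.ne hwu.symm)
      (apexDrawing_injective.ne hwv.symm) hmem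
    obtain ⟨hne, h | h⟩ := apexCrossedGrid_adj.1 huv
    · exact h.notMem_openSegment hne hwv hopen
    · rw [openSegment_symm] at hopen
      exact h.notMem_openSegment hne.symm hwu hopen
  right_angle _ _ _ _ huv hwz h := (apexCrossedGrid_crossNicely huv hwz h).1
  axis_parallel _ _ _ _ huv hwz h := (apexCrossedGrid_crossNicely huv hwz h).2

/-! ### Counting the edges -/

lemma sum_fin_succ_eq (hk : 0 < k) : ∑ i : Fin k, (if (i : ℕ) + 1 = k then (1 : ℤ) else 0) = 1 := by
  rw [Finset.sum_eq_single ⟨k - 1, by omega⟩]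
  · rw [if_pos (by simp only; omega)]
  · intro b _ hb
    rw [if_neg]
    intro h
    exact hb (Fin.ext (by simp only; omega))
  · simp

lemma sum_fin_eq_zero (hk : 0 < k) : ∑ i : Fin k, (if (i : ℕ) = 0 then (1 : ℤ) else 0) = 1 := by
  rw [Finset.sum_eq_single ⟨0, hk⟩]
  · simp
  · intro b _ hb
    rw [if_neg]
    intro h
    exact hb (Fin.ext h)
  · simp

/-- The number of pairs in `Fin k` at distance at most one. -/
lemma sum_fin_near (hk : 0 < k) : ∑ i : Fin k, ∑ j : Fin k,
    (if (i : ℕ) ≤ j + 1 ∧ (j : ℕ) ≤ i + 1 then (1 : ℤ) else 0) = 3 * k - 2 := by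
  have hsucc : ∑ i : Fin k, ∑ j : Fin k, (if (i : ℕ) + 1 = j then (1 : ℤ) else 0) = k - 1 := by
    have : ∀ i : Fin k, ∑ j : Fin k, (if (i : ℕ) + 1 = j then (1 : ℤ) else 0) =
        1 - if (i : ℕ) + 1 = k then (1 : ℤ) else 0 := by
      intro i
      by_cases h : (i : ℕ) + 1 = k
      · rw [if_pos h, sub_self]
        exact Finset.sum_eq_zero fun j _ => if_neg (by omega)
      · rw [if_neg h, Finset.sum_eq_single ⟨i + 1, by omega⟩]
        · simp
        · intro b _ hb
          rw [if_neg]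
          intro e
          exact hb (Fin.ext e.symm)
        · simp
    simp_rw [this, Finset.sum_sub_distrib, sum_fin_succ_eq hk]
    simp
  have hsplit : ∀ i j : Fin k, (if (i : ℕ) ≤ j + 1 ∧ (j : ℕ) ≤ i + 1 then (1 : ℤ) else 0) =
      (if i = j then 1 else 0) + (if (i : ℕ) + 1 = j then 1 else 0) +
        (if (j : ℕ) + 1 = i then 1 else 0) := by
    intro i j
    simp only [Fin.ext_iff]
    split_ifs <;> omega
  simp_rw [hsplit, Finset.sum_add_distrib, hsucc]
  rw [Finset.sum_comm (f := fun i j : Fin k => if (j : ℕ) + 1 = i then (1 : ℤ) else 0), hsucc]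
  simp
  ring

lemma sum_prod_or (f g : Fin k → Prop) [DecidablePred f] [DecidablePred g]
    (hf : ∑ i, (if f i then (1 : ℤ) else 0) = 1) (hg : ∑ i, (if g i then (1 : ℤ) else 0) = 1) :
    ∑ a : Fin k × Fin k, (if f a.1 ∨ g a.2 then (1 : ℤ) else 0) = 2 * k - 1 := by
  have hsplit : ∀ i j : Fin k, (if f i ∨ g j then (1 : ℤ) else 0) =
      (if f i then 1 else 0) + (if g j then 1 else 0) -
        (if f i then 1 else 0) * (if g j then 1 else 0) := by
    intro i j
    by_cases h1 : f i <;> by_cases h2 : g j <;> simp [h1, h2]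
  simp_rw [Fintype.sum_prod_type, hsplit, Finset.sum_sub_distrib, Finset.sum_add_distrib,
    ← Finset.mul_sum, hg, mul_one, hf, Finset.sum_const, ← Finset.smul_sum, hf]
  simp
  ring

open Classical in
lemma sum_crossedGrid_adj (hk : 0 < k) : ∑ a : Fin k × Fin k, ∑ b : Fin k × Fin k,
    (if (crossedGrid k).Adj a b then (1 : ℤ) else 0) = (3 * k - 2) ^ 2 - k ^ 2 := by
  -- Adjacency means being near in both coordinates without being equal, so the count factors up to
  -- the diagonal.
  have hsplit : ∀ i i' j j' : Fin k, (if (crossedGrid k).Adj (i, i') (j, j') then (1 : ℤ) else 0) =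
      (if (i : ℕ) ≤ j + 1 ∧ (j : ℕ) ≤ i + 1 then 1 else 0) *
        (if (i' : ℕ) ≤ j' + 1 ∧ (j' : ℕ) ≤ i' + 1 then 1 else 0) -
        (if i = j then 1 else 0) * (if i' = j' then 1 else 0) := by
    intro i i' j j'
    rw [crossedGrid_adj_iff]
    by_cases h : i = j <;> by_cases h' : i' = j'
    · subst h h'; simp
    · simp [h, h', ite_and]
    · simp [h, h', ite_and]
    · simp only [ne_eq, Prod.mk.injEq, h, h', and_self, not_false_eq_true, true_and, if_false,
        mul_zero, sub_zero, ite_and, ite_mul, one_mul, zero_mul]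
  simp_rw [Fintype.sum_prod_type, hsplit, Finset.sum_sub_distrib, ← Finset.mul_sum]
  rw [sq (3 * (k : ℤ) - 2), ← sum_fin_near hk, Finset.sum_mul]
  congr 1
  · refine Finset.sum_congr rfl fun i _ => ?_
    simp_rw [← Finset.sum_mul, ← Finset.mul_sum]
  · simp
    ring

/-- By the handshake lemma, the grid contributes half of `(3k - 2)² - k²`, each apex `2k - 1`, and
the edge `NS` one more. -/
lemma apexCrossedGrid_ncard_edgeSet (hk : 0 < k) :
    ((apexCrossedGrid k).edgeSet.ncard : ℤ) = 4 * k ^ 2 - 2 * k + 1 := by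
  classical
  have h := (apexCrossedGrid k).sum_degrees_eq_twice_card_edges
  rw [← SimpleGraph.coe_edgeFinset, Set.ncard_coe_finset]
  have h2 : ∀ x, ((apexCrossedGrid k).degree x : ℤ) =
      ∑ y, if (apexCrossedGrid k).Adj x y then 1 else 0 := by
    intro x
    rw [← SimpleGraph.card_neighborFinset_eq_degree, SimpleGraph.neighborFinset_eq_filter,
      Finset.card_filter]
    push_cast
    rfl
  have h3 : ((∑ x, (apexCrossedGrid k).degree x : ℕ) : ℤ) =
      2 * ((apexCrossedGrid k).edgeFinset.card : ℤ) := by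
    rw [h]; push_cast; rfl
  push_cast at h3
  simp_rw [h2] at h3
  have hN : ∀ a : Fin k × Fin k, (apexCrossedGrid k).Adj (.inl a) (.inr true) ↔
      (a.1 : ℕ) + 1 = k ∨ (a.2 : ℕ) + 1 = k := by
    simp [apexCrossedGrid_adj, ApexEdge]
  have hS : ∀ a : Fin k × Fin k, (apexCrossedGrid k).Adj (.inl a) (.inr false) ↔
      (a.1 : ℕ) = 0 ∨ (a.2 : ℕ) = 0 := by
    simp [apexCrossedGrid_adj, ApexEdge]
  have hgrid : ∀ a b : Fin k × Fin k, (apexCrossedGrid k).Adj (.inl a) (.inl b) ↔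
      (crossedGrid k).Adj a b := by
    intro a b
    simp only [apexCrossedGrid_adj, ApexEdge, SimpleGraph.adj_comm _ b a, or_self, ne_eq,
      Sum.inl.injEq, and_iff_right_iff_imp]
    exact SimpleGraph.Adj.ne
  have hNS : (apexCrossedGrid k).Adj (.inr true) (.inr false) := by
    simp [apexCrossedGrid_adj, ApexEdge]
  have sN : ∑ a : Fin k × Fin k, (if (apexCrossedGrid k).Adj (.inl a) (.inr true) then (1 : ℤ)
      else 0) = 2 * k - 1 :=
    (Finset.sum_congr rfl fun a _ => if_congr (hN a) rfl rfl).trans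
      (sum_prod_or _ _ (sum_fin_succ_eq hk) (sum_fin_succ_eq hk))
  have sS : ∑ a : Fin k × Fin k, (if (apexCrossedGrid k).Adj (.inl a) (.inr false) then (1 : ℤ)
      else 0) = 2 * k - 1 :=
    (Finset.sum_congr rfl fun a _ => if_congr (hS a) rfl rfl).trans
      (sum_prod_or _ _ (sum_fin_eq_zero hk) (sum_fin_eq_zero hk))
  have sG : ∑ a : Fin k × Fin k, ∑ b : Fin k × Fin k,
      (if (apexCrossedGrid k).Adj (.inl a) (.inl b) then (1 : ℤ) else 0) =
        (3 * k - 2) ^ 2 - k ^ 2 :=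
    (Finset.sum_congr rfl fun a _ => Finset.sum_congr rfl fun b _ =>
      if_congr (hgrid a b) rfl rfl).trans (sum_crossedGrid_adj hk)
  have hswap : ∀ (q : Bool) (a : Fin k × Fin k),
      (if (apexCrossedGrid k).Adj (.inr q) (.inl a) then (1 : ℤ) else 0) =
        if (apexCrossedGrid k).Adj (.inl a) (.inr q) then 1 else 0 := fun q a =>
    if_congr (SimpleGraph.adj_comm _ _ _) rfl rfl
  simp only [Fintype.sum_sum_type, Fintype.sum_bool, Finset.sum_add_distrib, hswap, sN, sS, sG,
    if_pos hNS, if_pos hNS.symm, SimpleGraph.irrefl, if_false] at h3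
  linarith

lemma floor_sqrt_sq_add_two {k : ℕ} (hk : 2 ≤ k) : ⌊√((k ^ 2 + 2 : ℕ) : ℝ)⌋ = k := by
  have hk' : (2 : ℝ) ≤ k := by exact_mod_cast hk
  rw [Int.floor_eq_iff]
  push_cast
  constructor
  · apply Real.le_sqrt_of_sq_le
    linarith
  · rw [Real.sqrt_lt' (by linarith)]
    nlinarith

end ApexCrossedGrid

theorem mainTheorem3 :
    (∀ (V : Type*) [Fintype V] (G : SimpleGraph V), 3 ≤ Fintype.card V → IsApRACGraph G →
      (G.edgeSet.ncard : ℝ) ≤ 4 * (Fintype.card V : ℝ) - √(Fintype.card V : ℝ) - 6) ∧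
    (∀ k : ℕ, 0 < k → Even k →
      ∃ n : ℕ, n = k ^ 2 + 2 ∧ Fintype.card ((Fin k × Fin k) ⊕ Bool) = n ∧
        IsApRACGraph (apexCrossedGrid k) ∧
        ((apexCrossedGrid k).edgeSet.ncard : ℤ) = 4 * (n : ℤ) - 2 * ⌊√(n : ℝ)⌋ - 7) := by
  refine ⟨fun V _ G hn hG => hG.ncard_edgeSet_le hn, fun k hk hev => ⟨k ^ 2 + 2, rfl, ?_,
    ⟨apexDrawing k, apexDrawing_isApRACDrawing k⟩, ?_⟩⟩
  · simp [sq]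
  · obtain ⟨m, hm⟩ := hev
    rw [apexCrossedGrid_ncard_edgeSet hk, floor_sqrt_sq_add_two (by omega)]
    push_cast
    ring
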